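/- Let $n, r\ge 0$ be integers with $n \ge 3.5r+1$, let $[n]=\{1,2,\dots,n\}$, and let $\mathcal F\subset 2^{[n]}$ be a family of subsets of $[n]$ that is $2r$-union, that is, $|F\cup F'|\le 2r$ for all $F,F'\in\mathcal F$ (where $F=F'$ is allowed). Write $\mathcal F^{(\ge r)}=\{F\in\mathcal F\colon |F|\ge r\}$, and let $\binom{[n]}{r}$ denote the family of all $r$-element subsets of $[n]$. Then $$|\mathcal F^{(\ge r)}|\le\binom nr,$$ with equality if and only if $\mathcal F^{(\ge r)}=\binom{[n]}{r}$. -/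

import Mathlib

/-- A family `F` of subsets of `[n]` (modelled by `Fin n`) is `u`-union if `|A ∪ B| ≤ u` for all
`A, B ∈ F`; the two members need not be distinct, so in particular every member has size at most
`u`. -/
def IsUnionFamily {n : ℕ} (u : ℕ) (F : Finset (Finset (Fin n))) : Prop :=
  ∀ A ∈ F, ∀ B ∈ F, (A ∪ B).card ≤ u

/-- The subfamily `F^{(≥ l)}` of the members of `F` of size at least `l`. -/
def layersGE {n : ℕ} (l : ℕ) (F : Finset (Finset (Fin n))) : Finset (Finset (Fin n)) :=
  F.filter (fun A => l ≤ A.card)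

/-- The full `k`-th layer: all `k`-element subsets of `[n]`. -/
def fullLayer (n k : ℕ) : Finset (Finset (Fin n)) :=
  Finset.powersetCard k Finset.univ


/-!
Complements of the members of a `2r`-union family of subsets of `[n]` pairwise meet in at least
`n - 2r` elements. Katona's theorem, proved by compression, bounds the shadows of such a family from
below: for `n` large compared with `r`, the sets of size `r + j` in `F` number at most `2 ^ (-j)`
times the number of `r`-sets disjoint from a member of `F` larger than `r`. Summing over
`1 ≤ j ≤ r`, the layers above the `r`-th together have fewer members than there are such `r`-sets.
As none of these `r`-sets belongs to `F`, trading the upper layers for them strictly enlarges the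
family inside the `r`-th layer of the cube.
-/

open Finset
open scoped FinsetFamily

/-- Any two members of `𝒜`, possibly equal, have at least `t` common elements. (Mathlib's
`Set.IsIntersectingOf (Set.Ici t)` only constrains distinct members.) -/
def IsTIntersecting {α : Type*} [DecidableEq α] (t : ℕ) (𝒜 : Finset (Finset α)) : Prop :=
  ∀ A ∈ 𝒜, ∀ B ∈ 𝒜, t ≤ #(A ∩ B)

section Compression

variable {α : Type*} [DecidableEq α] {𝒜 : Finset (Finset α)} {A B V : Finset α} {a b : α} {t : ℕ}

theorem IsTIntersecting.mono {ℬ : Finset (Finset α)} (h𝒜 : IsTIntersecting t 𝒜) (h : ℬ ⊆ 𝒜) :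
    IsTIntersecting t ℬ :=
  fun A hA B hB => h𝒜 A (h hA) B (h hB)

theorem compress_singleton_of_mem_of_notMem (hb : b ∈ A) (ha : a ∉ A) :
    UV.compress {a} {b} A = insert a (A.erase b) := by
  rw [UV.compress_of_disjoint_of_le (by simpa using ha) (by simpa using hb)]
  grind

theorem compress_singleton_of_not (h : ¬ (b ∈ A ∧ a ∉ A)) : UV.compress {a} {b} A = A := by
  rw [UV.compress, if_neg]
  rw [disjoint_singleton_left, singleton_subset_iff]
  tauto

theorem mem_compression_singleton :
    A ∈ 𝓒 {a} {b} 𝒜 ↔ A ∈ 𝒜 ∧ UV.compress {a} {b} A ∈ 𝒜 ∨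
      A ∉ 𝒜 ∧ ∃ B ∈ 𝒜, b ∈ B ∧ a ∉ B ∧ insert a (B.erase b) = A := by
  rw [UV.mem_compression]
  refine or_congr_right (and_congr_right fun hA => exists_congr fun B =>
    and_congr_right fun hB => ⟨fun h => ?_, ?_⟩)
  · obtain ⟨hbB, haB⟩ : b ∈ B ∧ a ∉ B := by
      by_contra hB'
      exact hA (h ▸ (compress_singleton_of_not hB').symm ▸ hB)
    exact ⟨hbB, haB, compress_singleton_of_mem_of_notMem hbB haB ▸ h⟩
  · rintro ⟨hbB, haB, rfl⟩
    exact compress_singleton_of_mem_of_notMem hbB haB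

theorem card_insert_erase (hb : b ∈ A) (ha : a ∉ A) : #(insert a (A.erase b)) = #A := by
  rw [card_insert_of_notMem (mt mem_of_mem_erase ha), card_erase_add_one hb]

theorem IsTIntersecting.le_card_insert_erase_inter (h𝒜 : IsTIntersecting t 𝒜)
    (hA : A ∈ 𝒜) (hbA : b ∈ A) (haA : a ∉ A) (hB : B ∈ 𝒜) (hB' : UV.compress {a} {b} B ∈ 𝒜) :
    t ≤ #(insert a (A.erase b) ∩ B) := by
  by_cases hbB : b ∈ B
  · by_cases haB : a ∈ B
    · have : insert a (A.erase b) ∩ B = insert a ((A ∩ B).erase b) := by grind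
      rw [this, card_insert_erase (by grind) (by grind)]
      exact h𝒜 A hA B hB
    · rw [compress_singleton_of_mem_of_notMem hbB haB] at hB'
      have : insert a (A.erase b) ∩ B = A ∩ insert a (B.erase b) := by grind
      rw [this]
      exact h𝒜 A hA _ hB'
  · exact (h𝒜 A hA B hB).trans (card_le_card (by grind))

theorem IsTIntersecting.compression (h𝒜 : IsTIntersecting t 𝒜) (a b : α) :
    IsTIntersecting t (𝓒 {a} {b} 𝒜) := by
  intro A' hA' B' hB'
  rcases mem_compression_singleton.1 hA' with ⟨hA, hcA⟩ | ⟨-, A, hA, hbA, haA, rfl⟩ <;>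
    rcases mem_compression_singleton.1 hB' with ⟨hB, hcB⟩ | ⟨-, B, hB, hbB, haB, rfl⟩
  · exact h𝒜 A' hA B' hB
  · rw [inter_comm]
    exact h𝒜.le_card_insert_erase_inter hB hbB haB hA hcA
  · exact h𝒜.le_card_insert_erase_inter hA hbA haA hB hcB
  · have hinter : insert a (A.erase b) ∩ insert a (B.erase b) = insert a ((A ∩ B).erase b) := by
      grind
    rw [hinter, card_insert_erase (by grind) (by grind)]
    exact h𝒜 A hA B hB

theorem compression_singleton_subset_powerset (hV : 𝒜 ⊆ V.powerset) (ha : a ∈ V) (b : α) :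
    𝓒 {a} {b} 𝒜 ⊆ V.powerset := by
  intro A hA
  rcases mem_compression_singleton.1 hA with ⟨hA, -⟩ | ⟨-, B, hB, -, -, rfl⟩
  · exact hV hA
  · exact mem_powerset.2 <|
      insert_subset ha ((erase_subset b B).trans (mem_powerset.1 (hV hB)))

theorem shadow_iterate_compression_singleton_subset (a b : α) (𝒜 : Finset (Finset α)) (k : ℕ) :
    ∂^[k] (𝓒 {a} {b} 𝒜) ⊆ 𝓒 {a} {b} (∂^[k] 𝒜) := by
  induction k with
  | zero => rfl
  | succ k ih =>
    rw [Function.iterate_succ_apply', Function.iterate_succ_apply']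
    refine (shadow_mono ih).trans (UV.shadow_compression_subset_compression_shadow _ _ ?_)
    simpa using UV.isCompressed_self ∅ _

theorem card_filter_mem_compression_lt (h : ¬ UV.IsCompressed {a} {b} 𝒜) :
    #{A ∈ 𝓒 {a} {b} 𝒜 | b ∈ A} < #{A ∈ 𝒜 | b ∈ A} := by
  have hab : a ≠ b := by
    rintro rfl
    exact h (UV.isCompressed_self _ _)
  obtain ⟨A, hA, hA'⟩ : ∃ A ∈ 𝒜, A ∉ 𝓒 {a} {b} 𝒜 := by
    by_contra! hsub
    exact h (eq_of_subset_of_card_le hsub (UV.card_compression _ _ _).le).symm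
  have hbA : b ∈ A := by
    by_contra hbA
    refine hA' (mem_compression_singleton.2 (.inl ⟨hA, ?_⟩))
    rwa [compress_singleton_of_not (by tauto)]
  refine card_lt_card ((ssubset_iff_of_subset fun B hB => ?_).2
    ⟨A, mem_filter.2 ⟨hA, hbA⟩, fun h' => hA' (mem_filter.1 h').1⟩)
  obtain ⟨hB, hbB⟩ := mem_filter.1 hB
  rcases mem_compression_singleton.1 hB with ⟨hB, -⟩ | ⟨-, C, -, -, -, rfl⟩
  · exact mem_filter.2 ⟨hB, hbB⟩
  · simp [hab.symm] at hbB

theorem exists_isCompressed_of_compression_closed {P : Finset (Finset α) → Prop}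
    (hP : ∀ a ∈ V, ∀ ℬ, P ℬ → P (𝓒 {a} {b} ℬ)) (h𝒜 : P 𝒜) :
    ∃ ℬ, P ℬ ∧ ∀ a ∈ V, UV.IsCompressed {a} {b} ℬ := by
  obtain ⟨ℬ, hℬ, hmin⟩ :=
    exists_minimalFor_of_wellFoundedLT P (fun ℬ => #{A ∈ ℬ | b ∈ A}) ⟨𝒜, h𝒜⟩
  refine ⟨ℬ, hℬ, fun a ha => by_contra fun hab => ?_⟩
  have hlt := card_filter_mem_compression_lt hab
  exact hlt.not_ge (hmin (hP a ha ℬ hℬ) hlt.le)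

end Compression

section Arithmetic

theorem choose_add_mul_succ (s k : ℕ) :
    (s + k).choose k * (s + 1 + k) = (s + 1 + k).choose k * (s + 1) := by
  rw [add_right_comm, Nat.choose_mul_succ_eq, Nat.sub_add_comm (Nat.le_add_left k s),
    Nat.add_sub_cancel]

theorem mul_choose_succ_le_mul_choose_succ {t s k x y : ℕ} (hk : k ≤ t)
    (h : x * (t + s).choose k ≤ y * (s + k).choose k) :
    x * (t + (s + 1)).choose k ≤ y * (s + 1 + k).choose k := by
  obtain ⟨j, rfl⟩ := Nat.exists_eq_add_of_le' hk
  have hratio : (j + s + 1 + k) * (s + 1) ≤ (s + 1 + k) * (j + s + 1) := by nlinarith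
  rw [show j + k + s = j + s + k by ring] at h
  rw [show j + k + (s + 1) = j + s + 1 + k by ring]
  refine Nat.le_of_mul_le_mul_right (c := (j + s + 1) * (s + 1)) ?_ (by positivity)
  calc x * (j + s + 1 + k).choose k * ((j + s + 1) * (s + 1))
      = x * (j + s + k).choose k * ((j + s + 1 + k) * (s + 1)) := by
        linear_combination (x * (s + 1)) * (choose_add_mul_succ (j + s) k).symm
    _ ≤ y * (s + k).choose k * ((s + 1 + k) * (j + s + 1)) := Nat.mul_le_mul h hratio
    _ = y * (s + 1 + k).choose k * ((j + s + 1) * (s + 1)) := by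
        linear_combination (y * (j + s + 1)) * choose_add_mul_succ s k

theorem two_pow_mul_choose_le {s j k : ℕ} (h : 2 * s + j + 1 ≤ 2 * k) :
    2 ^ j * (s + k).choose k ≤ (s + j + k).choose k := by
  induction j using Nat.twoStepInduction generalizing s with
  | zero => simp
  | one =>
    refine Nat.le_of_mul_le_mul_right (c := s + 1) ?_ s.succ_pos
    calc 2 ^ 1 * (s + k).choose k * (s + 1)
        = (s + k).choose k * (2 * (s + 1)) := by ring
      _ ≤ (s + k).choose k * (s + 1 + k) := Nat.mul_le_mul_left _ (by omega)
      _ = (s + 1 + k).choose k * (s + 1) := choose_add_mul_succ s k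
  | more j ih _ =>
    -- The quotient of the two binomials is `∏ (m + k) / m` over `s < m ≤ s + j + 2`. Its outer
    -- factors `m = a` and `m = b` have product at least `4` because `a + b ≤ 2 * k`.
    obtain ⟨a, ha⟩ : ∃ a, a = s + 1 := ⟨_, rfl⟩
    obtain ⟨b, hb⟩ : ∃ b, b = s + (j + 2) := ⟨_, rfl⟩
    have hab : a + b ≤ 2 * k := by omega
    have houter : 4 * (a * b) ≤ (a + k) * (b + k) := by
      nlinarith [Nat.mul_le_mul hab hab, Nat.mul_le_mul_left k hab, sq_nonneg ((a : ℤ) - b)]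
    have hsucc_a : (s + k).choose k * (a + k) = (a + k).choose k * a := by
      rw [ha, choose_add_mul_succ]
    have hsucc_b : (a + j + k).choose k * (b + k) = (b + k).choose k * b := by
      rw [hb, ha, add_right_comm s 1 j, show s + (j + 2) = s + j + 1 + 1 by ring,
        choose_add_mul_succ]
    have hinner : 2 ^ j * (a + k).choose k ≤ (a + j + k).choose k := ih (by omega)
    rw [← hb]
    refine Nat.le_of_mul_le_mul_right (c := (a + k) * b) ?_ (Nat.mul_pos (by omega) (by omega))
    calc 2 ^ (j + 2) * (s + k).choose k * ((a + k) * b)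
        = 2 ^ j * (a + k).choose k * (4 * (a * b)) := by
          linear_combination (2 ^ (j + 2) * b) * hsucc_a
      _ ≤ (a + j + k).choose k * ((a + k) * (b + k)) := Nat.mul_le_mul hinner houter
      _ = (b + k).choose k * ((a + k) * b) := by linear_combination (a + k) * hsucc_b

theorem sum_Ico_lt_of_two_pow_mul_le {x : ℕ → ℕ} {N r : ℕ} (hN : 0 < N)
    (h : ∀ j ∈ Ico 1 (r + 1), 2 ^ j * x j ≤ N) : ∑ j ∈ Ico 1 (r + 1), x j < N := by
  suffices 2 ^ r * ∑ j ∈ Ico 1 (r + 1), x j + N ≤ 2 ^ r * N from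
    lt_of_mul_lt_mul_left' (by omega : 2 ^ r * _ < 2 ^ r * N)
  induction r with
  | zero => simp
  | succ r ih =>
    rw [sum_Ico_succ_top (Nat.le_add_left 1 r)]
    have hlast := h (r + 1) (by simp)
    have hinit := ih fun j hj => h j (Ico_subset_Ico_right (Nat.le_succ _) hj)
    rw [pow_succ] at hlast ⊢
    linarith

end Arithmetic

section Shadow

variable {α : Type*} [DecidableEq α] {𝒜 : Finset (Finset α)} {V : Finset α} {m : α} {t s k : ℕ}

theorem card_shadow_iterate_memberSubfamily_add_nonMemberSubfamily_le (m : α)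
    (𝒜 : Finset (Finset α)) (k : ℕ) :
    #(∂^[k] (𝒜.memberSubfamily m)) + #(∂^[k] (𝒜.nonMemberSubfamily m)) ≤ #(∂^[k] 𝒜) := by
  rw [← card_memberSubfamily_add_card_nonMemberSubfamily m (∂^[k] 𝒜)]
  refine add_le_add (card_le_card fun B hB => ?_) (card_le_card fun B hB => ?_) <;>
    obtain ⟨A, hA, hBA, hcard⟩ := mem_shadow_iterate_iff_exists_mem_card_add.1 hB
  · obtain ⟨hA, hmA⟩ := mem_memberSubfamily.1 hA
    have hmB : m ∉ B := fun h => hmA (hBA h)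
    refine mem_memberSubfamily.2 ⟨mem_shadow_iterate_iff_exists_mem_card_add.2
      ⟨insert m A, hA, insert_subset_insert m hBA, ?_⟩, hmB⟩
    rw [card_insert_of_notMem hmA, card_insert_of_notMem hmB]
    omega
  · obtain ⟨hA, hmA⟩ := mem_nonMemberSubfamily.1 hA
    exact mem_nonMemberSubfamily.2 ⟨mem_shadow_iterate_iff_exists_mem_card_add.2
      ⟨A, hA, hBA, hcard⟩, fun h => hmA (hBA h)⟩

theorem card_mul_choose_le_card_shadow_iterate_mul_choose {r : ℕ} (hV : 𝒜 ⊆ V.powerset)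
    (hr : (𝒜 : Set (Finset α)).Sized r) (k : ℕ) :
    #𝒜 * r.choose k ≤ #(∂^[k] 𝒜) * (#V - r + k).choose k := by
  refine card_mul_le_card_mul (fun A B => B ⊆ A) (fun A hA => ?_) (fun B hB => ?_)
  · rw [← hr hA, ← card_powersetCard]
    refine card_le_card_of_injOn (A \ ·) (fun C hC => ?_) fun C hC D hD hCD => ?_
    · obtain ⟨hCA, rfl⟩ := mem_powersetCard.1 hC
      exact (mem_bipartiteAbove _).2 ⟨mem_shadow_iterate_iff_exists_mem_card_add.2
        ⟨A, hA, sdiff_subset, (card_sdiff_add_card_eq_card hCA).symm⟩, sdiff_subset⟩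
    · exact (sdiff_right_inj (mem_powersetCard.1 hC).1 (mem_powersetCard.1 hD).1).1 hCD
  · obtain ⟨A, hA, hBA, hcard⟩ := mem_shadow_iterate_iff_exists_mem_card_add.1 hB
    have hAV := mem_powerset.1 (hV hA)
    have hcompl : #(V \ B) = #V - r + k := by
      have := card_le_card hAV
      rw [card_sdiff_of_subset (hBA.trans hAV)]
      grind [hr hA]
    rw [← hcompl, ← card_powersetCard]
    refine card_le_card_of_injOn (· \ B) (fun C hC => ?_)
      ((superset_injOn_sdiff B).mono fun C hC => ((mem_bipartiteBelow _).1 hC).2)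
    obtain ⟨hC, hBC⟩ := (mem_bipartiteBelow _).1 hC
    refine mem_powersetCard.2 ⟨sdiff_subset_sdiff (mem_powerset.1 (hV hC)) Subset.rfl, ?_⟩
    rw [card_sdiff_of_subset hBC, hr hC, ← hr hA, hcard, Nat.add_sub_cancel_left]

theorem IsTIntersecting.exists_isCompressed (hV : 𝒜 ⊆ V.powerset)
    {r : ℕ} (hr : (𝒜 : Set (Finset α)).Sized r) (h𝒜 : IsTIntersecting t 𝒜) (m : α) (k : ℕ) :
    ∃ ℬ ⊆ V.powerset, (ℬ : Set (Finset α)).Sized r ∧ IsTIntersecting t ℬ ∧ #ℬ = #𝒜 ∧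
      #(∂^[k] ℬ) ≤ #(∂^[k] 𝒜) ∧ ∀ a ∈ V, UV.IsCompressed {a} {m} ℬ := by
  obtain ⟨ℬ, ⟨hV, hr, hℬ, hcard, hshadow⟩, hcomp⟩ :=
    exists_isCompressed_of_compression_closed (V := V) (b := m) (𝒜 := 𝒜)
      (P := fun ℬ => ℬ ⊆ V.powerset ∧ (ℬ : Set (Finset α)).Sized r ∧ IsTIntersecting t ℬ ∧
        #ℬ = #𝒜 ∧ #(∂^[k] ℬ) ≤ #(∂^[k] 𝒜))
      (fun a ha ℬ ⟨hV, hr, hℬ, hcard, hshadow⟩ =>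
        ⟨compression_singleton_subset_powerset hV ha m, hr.uvCompression rfl, hℬ.compression a m,
          (UV.card_compression _ _ _).trans hcard,
          (card_le_card (shadow_iterate_compression_singleton_subset a m ℬ k)).trans
            ((UV.card_compression _ _ _).trans_le hshadow)⟩)
      ⟨hV, hr, h𝒜, rfl, le_rfl⟩
  exact ⟨ℬ, hV, hr, hℬ, hcard, hshadow, hcomp⟩

theorem IsTIntersecting.memberSubfamily (hs : (𝒜 : Set (Finset α)).Sized (t + s))
    (h𝒜 : IsTIntersecting t 𝒜) (hm : ∀ a ∈ V, UV.IsCompressed {a} {m} 𝒜)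
    (hcard : t + 2 * s < #V) : IsTIntersecting t (𝒜.memberSubfamily m) := by
  intro A hA B hB
  obtain ⟨hA, hmA⟩ := mem_memberSubfamily.1 hA
  obtain ⟨hB, hmB⟩ := mem_memberSubfamily.1 hB
  by_contra! hlt
  -- Some `a` lies outside both sets, and trading `m` for `a` in the first one loses the common
  -- element `m`.
  have hunion : #(insert m A ∪ insert m B) ≤ t + 2 * s := by
    have hsum := card_union_add_card_inter (insert m A) (insert m B)
    have hinter := h𝒜 _ hA _ hB
    rw [hs hA, hs hB] at hsum
    omega
  obtain ⟨a, haV, ha⟩ := exists_mem_notMem_of_card_lt_card (hunion.trans_lt hcard)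
  have haA : a ∉ insert m A := by grind
  have hmem := UV.compress_mem_compression (u := {a}) (v := {m}) hA
  rw [hm a haV, compress_singleton_of_mem_of_notMem (mem_insert_self m A) haA] at hmem
  have hinter : insert a ((insert m A).erase m) ∩ insert m B = A ∩ B := by grind
  exact hlt.not_ge (hinter ▸ h𝒜 _ hmem _ hB)

theorem card_mul_choose_le_card_shadow_iterate_of_card_le (hV : 𝒜 ⊆ V.powerset)
    (hs : (𝒜 : Set (Finset α)).Sized (t + s)) (hcard : #V ≤ t + 2 * s) (k : ℕ) :
    #𝒜 * (t + s).choose k ≤ #(∂^[k] 𝒜) * (s + k).choose k :=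
  (card_mul_choose_le_card_shadow_iterate_mul_choose hV hs k).trans
    (Nat.mul_le_mul_left _ (Nat.choose_le_choose _ (by omega)))

theorem memberSubfamily_subset_powerset (hV : 𝒜 ⊆ (insert m V).powerset) :
    𝒜.memberSubfamily m ⊆ V.powerset := fun A hA => by
  obtain ⟨hA, hmA⟩ := mem_memberSubfamily.1 hA
  exact mem_powerset.2 <| (insert_subset_insert_iff hmA).1 (mem_powerset.1 (hV hA))

theorem nonMemberSubfamily_subset_powerset (hV : 𝒜 ⊆ (insert m V).powerset) :
    𝒜.nonMemberSubfamily m ⊆ V.powerset := fun A hA => by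
  obtain ⟨hA, hmA⟩ := mem_nonMemberSubfamily.1 hA
  exact mem_powerset.2 <| (subset_insert_iff_of_notMem hmA).1 (mem_powerset.1 (hV hA))

theorem card_add_one_of_mem_memberSubfamily {r : ℕ} (hr : (𝒜 : Set (Finset α)).Sized r)
    {A : Finset α} (hA : A ∈ 𝒜.memberSubfamily m) : #A + 1 = r := by
  obtain ⟨hA, hmA⟩ := mem_memberSubfamily.1 hA
  rw [← card_insert_of_notMem hmA, hr hA]

theorem IsTIntersecting.card_mul_choose_le_of_subset_powerset (hk : k ≤ t)
    (hV : 𝒜 ⊆ V.powerset) (hs : (𝒜 : Set (Finset α)).Sized (t + s)) (h𝒜 : IsTIntersecting t 𝒜) :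
    #𝒜 * (t + s).choose k ≤ #(∂^[k] 𝒜) * (s + k).choose k := by
  induction V using Finset.induction_on generalizing s 𝒜 with
  | empty => exact card_mul_choose_le_card_shadow_iterate_of_card_le hV hs (by simp) k
  | insert m V _ ih =>
    rcases le_or_gt #(insert m V) (t + 2 * s) with hcard | hcard
    · exact card_mul_choose_le_card_shadow_iterate_of_card_le hV hs hcard k
    obtain ⟨ℬ, hV, hs, hℬ, hcardℬ, hshadow, hcomp⟩ := h𝒜.exists_isCompressed hV hs m k
    have hnonMember : #(ℬ.nonMemberSubfamily m) * (t + s).choose k ≤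
        #(∂^[k] (ℬ.nonMemberSubfamily m)) * (s + k).choose k :=
      ih (nonMemberSubfamily_subset_powerset hV) (hs.mono (filter_subset _ _))
        (hℬ.mono (filter_subset _ _))
    have hint : IsTIntersecting t (ℬ.memberSubfamily m) := hℬ.memberSubfamily hs hcomp hcard
    have hmember : #(ℬ.memberSubfamily m) * (t + s).choose k ≤
        #(∂^[k] (ℬ.memberSubfamily m)) * (s + k).choose k := by
      cases s with
      | zero =>
        suffices ℬ.memberSubfamily m = ∅ by simp [this]
        refine eq_empty_of_forall_notMem fun A hA => ?_
        have hle : t ≤ #A := inter_self A ▸ hint A hA A hA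
        exact hle.not_gt (card_add_one_of_mem_memberSubfamily hs hA).le
      | succ s =>
        exact mul_choose_succ_le_mul_choose_succ hk (ih (memberSubfamily_subset_powerset hV)
          (fun A hA => Nat.succ_injective (card_add_one_of_mem_memberSubfamily hs hA)) hint)
    calc #𝒜 * (t + s).choose k
        = #(ℬ.memberSubfamily m) * (t + s).choose k +
            #(ℬ.nonMemberSubfamily m) * (t + s).choose k := by
          rw [← hcardℬ, ← card_memberSubfamily_add_card_nonMemberSubfamily m ℬ, add_mul]
      _ ≤ (#(∂^[k] (ℬ.memberSubfamily m)) + #(∂^[k] (ℬ.nonMemberSubfamily m))) *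
            (s + k).choose k := by
          rw [add_mul]
          exact add_le_add hmember hnonMember
      _ ≤ #(∂^[k] 𝒜) * (s + k).choose k :=
          Nat.mul_le_mul_right _ <|
            (card_shadow_iterate_memberSubfamily_add_nonMemberSubfamily_le m ℬ k).trans hshadow

/-- Katona's theorem on shadows of `t`-intersecting families. The bound is the one that double
counting gives when the members live in a set of `t + 2 * s` elements; a larger ground set does not
weaken it. -/
theorem IsTIntersecting.card_mul_choose_le (hk : k ≤ t)
    (hs : (𝒜 : Set (Finset α)).Sized (t + s)) (h𝒜 : IsTIntersecting t 𝒜) :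
    #𝒜 * (t + s).choose k ≤ #(∂^[k] 𝒜) * (s + k).choose k :=
  h𝒜.card_mul_choose_le_of_subset_powerset (V := 𝒜.sup id) hk
    (fun _ hA => mem_powerset.2 (le_sup (f := id) hA)) hs

theorem IsTIntersecting.two_pow_mul_card_le_card_shadow_iterate {j : ℕ}
    (hs : (𝒜 : Set (Finset α)).Sized (j + k + s)) (h𝒜 : IsTIntersecting (j + k) 𝒜)
    (h : 2 * s + j + 1 ≤ 2 * k) :
    2 ^ j * #𝒜 ≤ #(∂^[k] 𝒜) := by
  refine Nat.le_of_mul_le_mul_right (c := (s + k).choose k) ?_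
    (Nat.choose_pos (Nat.le_add_left k s))
  calc 2 ^ j * #𝒜 * (s + k).choose k
      = #𝒜 * (2 ^ j * (s + k).choose k) := by ring
    _ ≤ #𝒜 * (j + k + s).choose k := by
        rw [show j + k + s = s + j + k by ring]
        exact Nat.mul_le_mul_left _ (two_pow_mul_choose_le h)
    _ ≤ #(∂^[k] 𝒜) * (s + k).choose k := h𝒜.card_mul_choose_le (Nat.le_add_left k j) hs

end Shadow

section UnionFamily

variable {n r u : ℕ} {F : Finset (Finset (Fin n))}

/-- The `r`-subsets of `[n]` that are disjoint from a member of `F` of size greater than `r`; the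
`r`-th layer of a `2r`-union family contains none of them. -/
def disjointLayer (r : ℕ) (F : Finset (Finset (Fin n))) : Finset (Finset (Fin n)) :=
  {B ∈ fullLayer n r | ∃ A ∈ F, r < #A ∧ Disjoint A B}

theorem IsUnionFamily.isTIntersecting_compls (hF : IsUnionFamily u F) :
    IsTIntersecting (n - u) Fᶜˢ := by
  intro A hA B hB
  have hunion := hF _ (mem_compls.1 hA) _ (mem_compls.1 hB)
  rw [← compl_inter, card_compl, Fintype.card_fin] at hunion
  omega

theorem shadow_iterate_compls_slice_subset_disjointLayer {j k : ℕ} (hj : 0 < j)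
    (hk : n = 2 * r + j + k) : ∂^[k] (F # (r + j))ᶜˢ ⊆ disjointLayer r F := by
  intro B hB
  obtain ⟨A, hA, hBA, hcard⟩ := mem_shadow_iterate_iff_exists_mem_card_add.1 hB
  obtain ⟨hAF, hAcard⟩ := mem_slice.1 (mem_compls.1 hA)
  have hAB : Disjoint Aᶜ B := disjoint_compl_left_iff.2 hBA
  have hBr : #B = r := by
    have := card_add_card_compl A
    rw [Fintype.card_fin] at this
    omega
  exact mem_filter.2 ⟨mem_powersetCard_univ.2 hBr, Aᶜ, hAF, by omega, hAB⟩

theorem IsUnionFamily.two_pow_mul_card_slice_le (hF : IsUnionFamily (2 * r) F)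
    (hn : 7 * r + 1 ≤ 2 * n) {j : ℕ} (hj : j ∈ Ico 1 (r + 1)) :
    2 ^ j * #(F # (r + j)) ≤ #(disjointLayer r F) := by
  obtain ⟨hj₀, hjr⟩ := mem_Ico.1 hj
  obtain ⟨s, rfl⟩ := Nat.exists_eq_add_of_le (Nat.le_of_lt_succ hjr)
  obtain ⟨k, hk⟩ := Nat.exists_eq_add_of_le (show 2 * (j + s) + j ≤ n by omega)
  have hint : IsTIntersecting (j + k) (F # (j + s + j))ᶜˢ := by
    rw [show j + k = n - 2 * (j + s) by omega]
    exact hF.isTIntersecting_compls.mono (compls_subset_compls.2 slice_subset)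
  have hsized : ((F # (j + s + j))ᶜˢ : Set (Finset (Fin n))).Sized (j + k + s) := by
    have := (sized_slice (𝒜 := F) (r := j + s + j)).compls
    rwa [Fintype.card_fin, show n - (j + s + j) = j + k + s by omega] at this
  calc 2 ^ j * #(F # (j + s + j))
      = 2 ^ j * #(F # (j + s + j))ᶜˢ := by rw [card_compls]
    _ ≤ #(∂^[k] (F # (j + s + j))ᶜˢ) :=
        hint.two_pow_mul_card_le_card_shadow_iterate hsized (by omega)
    _ ≤ #(disjointLayer (j + s) F) :=
        card_le_card (shadow_iterate_compls_slice_subset_disjointLayer hj₀ hk)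

theorem IsUnionFamily.card_layersGE_succ_eq_sum (hF : IsUnionFamily (2 * r) F) :
    #(layersGE (r + 1) F) = ∑ j ∈ Ico 1 (r + 1), #(F # (r + j)) := by
  rw [card_eq_sum_card_fiberwise (f := fun A => #A - r) (t := Ico 1 (r + 1)) fun A hA => ?_]
  · refine sum_congr rfl fun j hj => congrArg card ?_
    ext A
    simp only [layersGE, mem_filter, mem_slice, mem_Ico] at hj ⊢
    grind
  · obtain ⟨hAF, hA⟩ := mem_filter.1 hA
    have := hF A hAF A hAF
    rw [union_self] at this
    exact mem_Ico.2 ⟨Nat.le_sub_of_add_le' hA, by grind⟩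

theorem IsUnionFamily.card_layersGE_succ_lt (hF : IsUnionFamily (2 * r) F)
    (hn : 7 * r + 1 ≤ 2 * n) (hne : (layersGE (r + 1) F).Nonempty) :
    #(layersGE (r + 1) F) < #(disjointLayer r F) := by
  rw [← card_pos, hF.card_layersGE_succ_eq_sum] at hne
  rw [hF.card_layersGE_succ_eq_sum]
  have hlayers (j : ℕ) (hj : j ∈ Ico 1 (r + 1)) := hF.two_pow_mul_card_slice_le hn hj
  obtain ⟨j, hj, hslice⟩ := sum_pos_iff.1 hne
  exact sum_Ico_lt_of_two_pow_mul_le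
    ((Nat.mul_pos (Nat.two_pow_pos j) hslice).trans_le (hlayers j hj)) hlayers

theorem IsUnionFamily.disjoint_slice_disjointLayer (hF : IsUnionFamily (2 * r) F) :
    Disjoint (F # r) (disjointLayer r F) := by
  refine disjoint_left.2 fun B hB hB' => ?_
  obtain ⟨hBF, hBr⟩ := mem_slice.1 hB
  obtain ⟨-, A, hAF, hA, hAB⟩ := mem_filter.1 hB'
  have hunion := hF A hAF B hBF
  rw [card_union_of_disjoint hAB] at hunion
  omega

theorem card_fullLayer (n r : ℕ) : #(fullLayer n r) = n.choose r := by
  rw [fullLayer, card_powersetCard, card_univ, Fintype.card_fin]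

theorem slice_subset_fullLayer (r : ℕ) (F : Finset (Finset (Fin n))) : F # r ⊆ fullLayer n r :=
  fun _ hA => mem_powersetCard_univ.2 (mem_slice.1 hA).2

theorem layersGE_eq_slice_union (r : ℕ) (F : Finset (Finset (Fin n))) :
    layersGE r F = F # r ∪ layersGE (r + 1) F := by
  ext A
  simp only [layersGE, mem_union, mem_filter, mem_slice]
  grind

theorem IsUnionFamily.card_layersGE_lt (hF : IsUnionFamily (2 * r) F)
    (hn : 7 * r + 1 ≤ 2 * n) (hne : (layersGE (r + 1) F).Nonempty) :
    #(layersGE r F) < n.choose r := by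
  calc #(layersGE r F)
      ≤ #(F # r) + #(layersGE (r + 1) F) := by
        rw [layersGE_eq_slice_union]
        exact card_union_le _ _
    _ < #(F # r) + #(disjointLayer r F) :=
        Nat.add_lt_add_left (hF.card_layersGE_succ_lt hn hne) _
    _ = #(F # r ∪ disjointLayer r F) :=
        (card_union_of_disjoint hF.disjoint_slice_disjointLayer).symm
    _ ≤ #(fullLayer n r) := card_le_card (union_subset (slice_subset_fullLayer r F)
        (filter_subset _ _))
    _ = n.choose r := card_fullLayer n r

end UnionFamily

theorem theorem1p9_general (n r : ℕ) (hn : 7 * r + 1 ≤ 2 * n)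
    (F : Finset (Finset (Fin n))) (hF : IsUnionFamily (2 * r) F) :
    (layersGE r F).card ≤ n.choose r ∧
      ((layersGE r F).card = n.choose r ↔ layersGE r F = fullLayer n r) := by
  rcases (layersGE (r + 1) F).eq_empty_or_nonempty with hempty | hne
  · have hsub : layersGE r F ⊆ fullLayer n r := by
      rw [layersGE_eq_slice_union, hempty, union_empty]
      exact slice_subset_fullLayer r F
    refine ⟨(card_le_card hsub).trans_eq (card_fullLayer n r), fun hcard => ?_, fun h => ?_⟩
    · exact eq_of_subset_of_card_le hsub (hcard.trans (card_fullLayer n r).symm).ge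
    · rw [h, card_fullLayer]
  · have hlt := hF.card_layersGE_lt hn hne
    refine ⟨hlt.le, fun hcard => absurd hcard hlt.ne, fun h => absurd ?_ hlt.ne⟩
    rw [h, card_fullLayer]

theorem theorem1p9 (n r : ℕ) (hn : (3.5 : ℝ) * (r : ℝ) + 1 ≤ (n : ℝ))
    (F : Finset (Finset (Fin n))) (hF : IsUnionFamily (2 * r) F) :
    (layersGE r F).card ≤ n.choose r ∧
      ((layersGE r F).card = n.choose r ↔ layersGE r F = fullLayer n r) := by
  have hn' : (7 * r + 1 : ℝ) ≤ 2 * n := by linarith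
  exact theorem1p9_general n r (by exact_mod_cast hn') F hF
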